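/- Let $p$ be an odd prime. Let $\widehat{\mathcal U}$ be the free noncommutative $\mathbb F_p$-algebra on generators $e_i$, $i\ge 0$, and put $e_i=0$ for integers $i<0$. Let $\widetilde{\mathcal U}$ (resp. $\mathcal U$) be the quotient of $\widehat{\mathcal U}$ by the two-sided ideal generated by the $e_i$ with $i$ odd (resp. with $i$ not divisible by $p-1$), and write $d_i=e_{i(p-1)}$ in $\mathcal U$. For $i,j\in\mathbb Z$ consider the relation $$e_ie_j\sim\sum_{k}(-1)^{\frac{pk-i}{p-1}}\binom{k-j-1}{\frac{pk-i}{p-1}-j}\,e_{i+pj-pk}\,e_k ,\qquad (R_{i,j})$$ where the numerator of a binomial coefficient may be any integer, a binomial coefficient with negative lower entry is $0$, and a term is present only if $\frac{pk-i}{p-1}$ is an integer. In $\widehat{\mathcal U}$ the full relations are the $R_{i,j}$ for all $i,j\in\mathbb Z$; in $\widetilde{\mathcal U}$ (resp. $\mathcal U$) they are the $R_{i,j}$ with $i,j\in\mathbb Z$ both even (resp. both divisible by $p-1$). The Adem relations are the full relations with $i,j\ge 0$; the full relations with $i<0$ or $j<0$ are called negative. Let $\widehat{\mathcal K},\widetilde{\mathcal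 K},\mathcal K$ be the quotient algebras of $\widehat{\mathcal U},\widetilde{\mathcal U},\mathcal U$ by their Adem relations. Then: (1) The following elements remain linearly independent over $\mathbb F_p$ when the negative relations are imposed as well, i.e. their images in the quotient by the full relations are linearly independent: - for $\widetilde{\mathcal K}$, the monomials $e_{i_1}\cdots e_{i_n}$, $n\ge 0$, with all $i_k$ even, $0\le i_1\le\cdots\le i_n$, and $i_k\equiv i_{k-1}\pmod{p-1}$ for $2\le k\le n$; - for $\widehat{\mathcal K}$, the same monomials with $n\ge 2$; - for $\mathcal K$, the monomials $d_{i_1}\cdots d_{i_n}$, $n\ge 0$, with $0\le i_1\le\cdots\le i_n$. (2) For each of $\widehat{\mathcal U},\widetilde{\mathcal U},\mathcal U$, imposing the full relations or only the Adem relations gives the same quotient: there is an isomorphism of $\mathbb F_p$-algebras between the two quotients that commutes with the quotient maps. -/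

import Mathlib

namespace KudoArakiMay

/-- Binomial coefficient with an arbitrary integer numerator `N`
(`N (N - 1) ⋯ (N - m + 1) / m!` for `m ≥ 0`), and zero for `m < 0`. -/
noncomputable def binom (N m : ℤ) : ℤ :=
  if 0 ≤ m then Ring.choose N m.toNat else 0

/-- The coefficient of `e_{i+pj-pk} e_k` on the right side of the relation indexed by `(i, j)`:
with `m = (pk - i)/(p - 1)` it is `(-1)^m * binom (k-j-1) (m-j)` if `m` is an integer,
and the term is absent otherwise. -/
noncomputable def coeff (p : ℕ) (i j k : ℤ) : ℤ :=
  if ((p : ℤ) - 1) ∣ (p * k - i) then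
    ((((p * k - i) / ((p : ℤ) - 1)).negOnePow : ℤˣ) : ℤ) *
      binom (k - j - 1) ((p * k - i) / ((p : ℤ) - 1) - j)
  else 0

/-- The right side `θ(i, j) = ∑_k coeff(i, j, k) e_{i+pj-pk} e_k`, for `i j : ℤ`, in an algebra
with elements `e : ℤ → A` that vanish at negative indices. Only the `k` with `k ≥ 0` and
`i + pj - pk ≥ 0` can contribute, and these are the `k` of the finite range of summation. -/
noncomputable def theta {A : Type*} [Ring A] (p : ℕ) (e : ℤ → A) (i j : ℤ) : A :=
  ∑ k ∈ Finset.Icc (0 : ℤ) ((i + p * j) / p), coeff p i j k • (e (i + p * j - p * k) * e k)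

/-- The summation range in `theta` omits only vanishing terms. -/
theorem theta_term_eq_zero {A : Type*} [Ring A] {p : ℕ} (hp : 0 < p) {e : ℤ → A}
    (he : ∀ n < 0, e n = 0) {i j k : ℤ} (hk : k ∉ Finset.Icc (0 : ℤ) ((i + p * j) / p)) :
    coeff p i j k • (e (i + p * j - p * k) * e k) = 0 := by
  have hp' : (0 : ℤ) < p := by exact_mod_cast hp
  rw [Finset.mem_Icc, not_and_or, not_le, not_le] at hk
  rcases hk with hk | hk
  · simp [he k hk]
  · have h : i + p * j - p * k < 0 := by
      have := (Int.ediv_lt_iff_lt_mul hp').1 hk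
      linarith
    simp [he _ h]

/-- The relations `e_i e_j ∼ θ(i, j)` for all integers `i, j` in the index set `S`. -/
def FullRel {A : Type*} [Ring A] (p : ℕ) (e : ℤ → A) (S : Set ℤ) (x y : A) : Prop :=
  ∃ i j : ℤ, i ∈ S ∧ j ∈ S ∧ x = e i * e j ∧ y = theta p e i j

/-- The relations `e_i e_j ∼ θ(i, j)` for the nonnegative integers `i, j` in the index set `S`. -/
def AdemRel {A : Type*} [Ring A] (p : ℕ) (e : ℤ → A) (S : Set ℤ) (x y : A) : Prop :=
  ∃ i j : ℤ, i ∈ S ∧ j ∈ S ∧ 0 ≤ i ∧ 0 ≤ j ∧ x = e i * e j ∧ y = theta p e i j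

/-- `Û`: the free noncommutative `𝔽_p`-algebra on generators `e_i`, `i ≥ 0`. -/
abbrev UHat (p : ℕ) : Type := FreeAlgebra (ZMod p) ℕ

/-- The elements `e_i` of `Û` for `i : ℤ`, with `e_i = 0` for `i < 0`. -/
noncomputable def eHat (p : ℕ) (i : ℤ) : UHat p :=
  if 0 ≤ i then FreeAlgebra.ι (ZMod p) i.toNat else 0

/-- `Ũ`: the quotient of `Û` by the two-sided ideal generated by the `e_i` with `i` odd. -/
abbrev UTilde (p : ℕ) : Type :=
  RingQuot (fun x y : UHat p => (∃ i : ℤ, ¬ Even i ∧ x = eHat p i) ∧ y = 0)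

/-- The images of the `e_i` in `Ũ`. -/
noncomputable def eTilde (p : ℕ) (i : ℤ) : UTilde p := RingQuot.mkAlgHom (ZMod p) _ (eHat p i)

/-- `U`: the quotient of `Û` by the two-sided ideal generated by the `e_i` with `i` not
divisible by `p - 1`. -/
abbrev U (p : ℕ) : Type :=
  RingQuot (fun x y : UHat p => (∃ i : ℤ, ¬ (((p : ℤ) - 1) ∣ i) ∧ x = eHat p i) ∧ y = 0)

/-- The images of the `e_i` in `U`. -/
noncomputable def eU (p : ℕ) (i : ℤ) : U p := RingQuot.mkAlgHom (ZMod p) _ (eHat p i)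

/-- `K̂`, the quotient of `Û` by its Adem relations. -/
abbrev KHat (p : ℕ) : Type := RingQuot (AdemRel p (eHat p) Set.univ)

/-- `K̃`, the quotient of `Ũ` by its Adem relations. -/
abbrev KTilde (p : ℕ) : Type := RingQuot (AdemRel p (eTilde p) {i | Even i})

/-- `K`, the quotient of `U` by its Adem relations. -/
abbrev K (p : ℕ) : Type := RingQuot (AdemRel p (eU p) {i | ((p : ℤ) - 1) ∣ i})

/-- The quotient of `Û` by its full relations. -/
abbrev KHatFull (p : ℕ) : Type := RingQuot (FullRel p (eHat p) Set.univ)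

/-- The quotient of `Ũ` by its full relations. -/
abbrev KTildeFull (p : ℕ) : Type := RingQuot (FullRel p (eTilde p) {i | Even i})

/-- The quotient of `U` by its full relations. -/
abbrev KFull (p : ℕ) : Type := RingQuot (FullRel p (eU p) {i | ((p : ℤ) - 1) ∣ i})

/-- The quotient map `Û → K̂`. -/
noncomputable abbrev toKHat (p : ℕ) : UHat p →ₐ[ZMod p] KHat p := RingQuot.mkAlgHom (ZMod p) _

/-- The quotient map `Ũ → K̃`. -/
noncomputable abbrev toKTilde (p : ℕ) : UTilde p →ₐ[ZMod p] KTilde p :=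
  RingQuot.mkAlgHom (ZMod p) _

/-- The quotient map `U → K`. -/
noncomputable abbrev toK (p : ℕ) : U p →ₐ[ZMod p] K p := RingQuot.mkAlgHom (ZMod p) _

/-- The quotient map of `Û` by its full relations. -/
noncomputable abbrev toKHatFull (p : ℕ) : UHat p →ₐ[ZMod p] KHatFull p :=
  RingQuot.mkAlgHom (ZMod p) _

/-- The quotient map of `Ũ` by its full relations. -/
noncomputable abbrev toKTildeFull (p : ℕ) : UTilde p →ₐ[ZMod p] KTildeFull p :=
  RingQuot.mkAlgHom (ZMod p) _

/-- The quotient map of `U` by its full relations. -/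
noncomputable abbrev toKFull (p : ℕ) : U p →ₐ[ZMod p] KFull p := RingQuot.mkAlgHom (ZMod p) _

/-- The monomial `e_{i_1} ⋯ e_{i_n}` of a word `[i_1, …, i_n]` of natural numbers. -/
def monomial {A : Type*} [Ring A] (e : ℤ → A) (w : List ℕ) : A :=
  (w.map fun i : ℕ => e (i : ℤ)).prod

/-- The words `[i_1, …, i_n]` with all entries even, `i_1 ≤ ⋯ ≤ i_n`, and consecutive entries
congruent modulo `p - 1`. -/
def IsBasisWord (p : ℕ) (w : List ℕ) : Prop :=
  (∀ i ∈ w, Even i) ∧ w.IsChain fun a b => a ≤ b ∧ a ≡ b [MOD p - 1]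

/-- The elements `d_i = e_{i(p-1)}` of `U`. -/
noncomputable def dU (p : ℕ) (i : ℤ) : U p := eU p (i * ((p : ℤ) - 1))

end KudoArakiMay

/-!
The full relations say that the generating function of the products of two generators is symmetric.
For coefficients `c_{ij}` put `F(u, v) = ∑ c_{ij} u ^ i V ^ j` with `V = v ^ p - u ^ (p - 1) v`.
Setting `u = 1` in weight `N = i + p j`, the equation `F(u, v) = F(v, u)` becomes
`∑ c_b V ^ b = ∑ c_b v ^ (N - p b) (1 - v ^ (p - 1)) ^ b` for `V = v ^ p - v`, and the extraction of
the coefficient of `V ^ j`, a residue computation which is elementary because `dV = - dv` in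
characteristic `p`, gives exactly the relation indexed by `(i, j)`, for all integers `i` and `j`
(`eq_sum_coeff_of_sum_pow_eq`).

This yields representations of the full quotients. On the polynomial algebra on `t` and `y_{k,n}`
let `e_i` be the coefficient of `u ^ i` in the algebra homomorphism with `t ↦ t u ^ r` and
`y_{k,n} ↦ y_{k,n+1} + y_{k,n} u ^ ((p - 1) p ^ n)`. The symmetry of the twofold iterate has to be
checked on generators only, where it is visible for even `r` (`op_mul_op`). The iterates involve the
Dickson invariants, and their lowest terms are indexed by the basis words: composing with suitable
evaluations and taking the coefficient of a fixed monomial gives functionals which are triangular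
on words of a given length for the lexicographic order (`coeff_evalAt_prod_op`), and thus the linear
independence (`linearIndependent_full`). The case `r = 2` serves for `Û` and `Ũ`, the case
`r = p - 1` for `U`.

For the second part, the Adem relations alone reduce every product of two generators to the basis
words of length two (`mul_mem_span_basis`). So the right side of a negative relation is in `K̂` a
combination of basis words. It vanishes in the quotient by the full relations, where these words are
independent, and so it vanishes in `K̂` (`toKHat_theta_eq_zero`) and in every algebra in which the
Adem relations hold.
-/

namespace KudoArakiMay

/-! ### Vanishing of the coefficients -/

theorem coeff_eq_zero_of_not_dvd {p : ℕ} {i j k : ℤ} (h : ¬ ((p : ℤ) - 1) ∣ (p * k - i)) :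
    coeff p i j k = 0 := if_neg h

theorem coeff_eq_of_eq_mul {p : ℕ} (hp : 1 < p) {i j k m : ℤ}
    (h : (p : ℤ) * k - i = ((p : ℤ) - 1) * m) :
    coeff p i j k = ((m.negOnePow : ℤˣ) : ℤ) * binom (k - j - 1) (m - j) := by
  have h1 : (p : ℤ) - 1 ≠ 0 := by omega
  rw [coeff, if_pos ⟨m, h⟩, h, Int.mul_ediv_cancel_left _ h1]

/-- The lower entry of the binomial coefficient is negative. -/
theorem coeff_eq_zero_of_lt {p : ℕ} (hp : 1 < p) {i j k : ℤ}
    (h : (p : ℤ) * k < i + ((p : ℤ) - 1) * j) : coeff p i j k = 0 := by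
  by_cases hd : ((p : ℤ) - 1) ∣ (p * k - i)
  · obtain ⟨m, hm⟩ := hd
    have h1 : m < j := by
      by_contra! hjm
      have := mul_le_mul_of_nonneg_left hjm (show (0 : ℤ) ≤ (p : ℤ) - 1 by omega)
      linarith
    rw [coeff_eq_of_eq_mul hp hm, binom, if_neg (by omega), mul_zero]
  · exact coeff_eq_zero_of_not_dvd hd

/-- The numerator of the binomial coefficient is nonnegative and less than the lower entry. -/
theorem coeff_eq_zero_of_le_of_lt {p : ℕ} (hp : 1 < p) {i j k : ℤ} (hik : i ≤ k) (hjk : j < k) :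
    coeff p i j k = 0 := by
  by_cases hd : ((p : ℤ) - 1) ∣ (p * k - i)
  · obtain ⟨m, hm⟩ := hd
    have h1 : k ≤ m := by
      by_contra! hjm
      have := mul_lt_mul_of_pos_left hjm (show (0 : ℤ) < (p : ℤ) - 1 by omega)
      linarith
    rw [coeff_eq_of_eq_mul hp hm, binom, if_pos (by omega)]
    have h2 : k - j - 1 = ((k - j - 1).toNat : ℤ) := by omega
    rw [h2, Ring.choose_natCast, Nat.choose_eq_zero_of_lt (by omega)]
    simp
  · exact coeff_eq_zero_of_not_dvd hd

theorem binom_neg_one {m : ℤ} (hm : 0 ≤ m) : binom (-1) m = ((m.negOnePow : ℤˣ) : ℤ) := by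
  lift m to ℕ using hm
  rw [binom, if_pos (by omega), Ring.choose_neg]
  simp [Ring.choose_natCast, Units.smul_def]

/-- The diagonal coefficient of the relations with `i ≤ j` is `(-1)^j`. -/
theorem coeff_self {p : ℕ} (hp : 1 < p) {i j : ℤ} (hij : i ≤ j)
    (hd : ((p : ℤ) - 1) ∣ (p * j - i)) : coeff p i j j = ((j.negOnePow : ℤˣ) : ℤ) := by
  obtain ⟨m, hm⟩ := hd
  have h1 : j ≤ m := by
    by_contra! hjm
    have h2 : m ≤ j - 1 := by omega
    have := mul_le_mul_of_nonneg_left h2 (show (0 : ℤ) ≤ (p : ℤ) - 1 by omega)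
    have h3 : (1 : ℤ) < p := by exact_mod_cast hp
    nlinarith
  rw [coeff_eq_of_eq_mul hp hm, show j - j - 1 = -1 by ring, binom_neg_one (by omega),
    ← Units.val_mul, ← Int.negOnePow_add, show m + (m - j) = 2 * (m - j) + j by ring,
    Int.negOnePow_add, Int.negOnePow_two_mul, one_mul]

theorem theta_eq_zero_of_right_neg {A : Type*} [Ring A] {p : ℕ} (hp : 1 < p) (e : ℤ → A) {i j : ℤ}
    (hj : j < 0) : theta p e i j = 0 := by
  refine Finset.sum_eq_zero fun k hk => ?_
  rw [Finset.mem_Icc, Int.le_ediv_iff_mul_le (by omega)] at hk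
  rw [coeff_eq_zero_of_lt hp (by nlinarith [hk.2]), zero_smul]

theorem map_theta {A B F : Type*} [Ring A] [Ring B] [FunLike F A B] [RingHomClass F A B] (f : F)
    (p : ℕ) (e : ℤ → A) (i j : ℤ) : f (theta p e i j) = theta p (fun n => f (e n)) i j := by
  simp only [theta, map_sum, map_zsmul, map_mul]

/-! ### Products of two generators modulo the Adem relations -/

/-- The condition `i` even and `i ≡ j` modulo `p - 1` on the indices of a product `e_i e_j`. For
`i ≤ j` the products without this property vanish modulo the Adem relations. -/
def IsBasisParity (p : ℕ) (i j : ℤ) : Prop := Even i ∧ ((p : ℤ) - 1) ∣ (j - i)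

/-- All terms of a relation have indices of the same type: a relation exchanges the residues of the
two indices modulo `p - 1`. -/
theorem isBasisParity_iff {p : ℕ} (hp2 : Even ((p : ℤ) - 1)) {i j k : ℤ}
    (hd : ((p : ℤ) - 1) ∣ (p * k - i)) :
    IsBasisParity p (i + p * j - p * k) k ↔ IsBasisParity p i j := by
  have h1 : ((p : ℤ) - 1) ∣ k - (i + p * j - p * k) ↔ ((p : ℤ) - 1) ∣ (j - i) := by
    rw [show k - (i + p * j - p * k) =
      -(j - i) + ((p * k - i) - ((p : ℤ) - 1) * j + (p * k - i) - ((p : ℤ) - 1) * k) by ring,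
      dvd_add_left, dvd_neg]
    exact ((((hd.sub (dvd_mul_right _ _)).add hd).sub (dvd_mul_right _ _)))
  rw [IsBasisParity, IsBasisParity, h1]
  refine and_congr_left fun h => ?_
  have h2 : i + p * j - p * k - i = ((p : ℤ) - 1) * j + (j - i) - (p * k - i) := by ring
  have h3 : Even (i + p * j - p * k - i) := by
    rw [h2]
    exact ((hp2.mul_right _).add (even_iff_two_dvd.2 (hp2.two_dvd.trans h))).sub
      (even_iff_two_dvd.2 (hp2.two_dvd.trans hd))
  exact Int.even_sub.1 h3

section Adem

variable {R : Type*} [Ring R] {p : ℕ} {e : ℤ → R}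

/-- Products `e_a e_b` with `a ≤ b` without the property `IsBasisParity` vanish modulo the Adem
relations.
In the relation for `e_a e_b` only indices `k ≤ b` occur; the terms with `k < b` are products
without the property which either are of the same shape with a smaller second index, or become
combinations of such products when the relation is applied a second time. The diagonal
coefficient is `0` or `-1`. -/
theorem mul_eq_zero_of_not_isBasisParity (hp : 1 < p) (hodd : Odd p)
    (h2 : ∀ x : R, x + x = 0 → x = 0) (he : ∀ n < 0, e n = 0)
    (hrel : ∀ i j, 0 ≤ i → 0 ≤ j → e i * e j = theta p e i j) (b : ℕ) :
    ∀ a : ℤ, 0 ≤ a → a ≤ b → ¬ IsBasisParity p a b → e a * e b = 0 := by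
  have hp1 : (1 : ℤ) < p := by exact_mod_cast hp
  have hpe : Even ((p : ℤ) - 1) := by
    have : Odd (p : ℤ) := by exact_mod_cast hodd
    exact this.sub_odd odd_one
  induction b using Nat.strong_induction_on with
  | _ b ih =>
  intro a ha hab hbad
  have ih' : ∀ (c k : ℤ), c ≤ k → k < b → ¬ IsBasisParity p c k → e c * e k = 0 := by
    intro c k hck hkb hc
    rcases lt_or_ge c 0 with h | h
    · rw [he c h, zero_mul]
    · lift k to ℕ using h.trans hck
      exact ih k (by omega) c h hck hc
  -- The terms off the diagonal vanish, by the induction hypothesis if `0 ≤ k < b`.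
  have hterm : ∀ k ≠ (b : ℤ), coeff p a b k • (e (a + p * b - p * k) * e k) = 0 := by
    intro k hkb
    by_cases hd : ((p : ℤ) - 1) ∣ (p * k - a)
    swap; · rw [coeff_eq_zero_of_not_dvd hd, zero_smul]
    rcases lt_or_gt_of_ne hkb with hk | hk
    swap; · rw [coeff_eq_zero_of_le_of_lt hp (hab.trans hk.le) hk, zero_smul]
    by_cases hlt : (p : ℤ) * k < a + ((p : ℤ) - 1) * b
    · rw [coeff_eq_zero_of_lt hp hlt, zero_smul]
    have hbad' := mt (isBasisParity_iff (j := b) hpe hd).1 hbad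
    set a' := a + p * b - p * k with ha'
    have ha'b : a' ≤ b := by rw [ha']; linarith
    rcases le_or_gt a' k with hak | hak
    · rw [ih' a' k hak hk hbad', smul_zero]
    rcases lt_or_ge k 0 with hk0 | hk0
    · rw [he k hk0, mul_zero, smul_zero]
    -- Here `a' > k`, and the second application of a relation gives indices `k < l < a' ≤ b`.
    rw [hrel a' k (hk0.trans hak.le) hk0, theta, Finset.sum_eq_zero, smul_zero]
    intro l _
    by_cases hd' : ((p : ℤ) - 1) ∣ (p * l - a')
    swap; · rw [coeff_eq_zero_of_not_dvd hd', zero_smul]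
    by_cases hlt' : (p : ℤ) * l < a' + ((p : ℤ) - 1) * k
    · rw [coeff_eq_zero_of_lt hp hlt', zero_smul]
    have hkl : k < l := by nlinarith
    rcases le_or_gt a' l with hal | hal
    · rw [coeff_eq_zero_of_le_of_lt hp hal hkl, zero_smul]
    rw [ih' _ l (by linarith) (hal.trans_le ha'b) (mt (isBasisParity_iff hpe hd').1 hbad'),
      smul_zero]
  have key : e a * e b = coeff p a b b • (e a * e b) := by
    conv_lhs => rw [hrel a b ha (by omega), theta]
    by_cases hb : (b : ℤ) ∈ Finset.Icc (0 : ℤ) ((a + p * b) / p)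
    · rw [Finset.sum_eq_single_of_mem _ hb fun k _ hk => hterm k hk]
      simp
    · exfalso
      rw [Finset.mem_Icc, Int.le_ediv_iff_mul_le (by omega)] at hb
      exact hb ⟨by omega, by nlinarith⟩
  by_cases hd : ((p : ℤ) - 1) ∣ (p * b - a)
  · have hd2 : ((p : ℤ) - 1) ∣ (b - a) := by
      have := hd.sub (dvd_mul_right ((p : ℤ) - 1) b)
      rwa [show (p : ℤ) * b - a - ((p : ℤ) - 1) * b = b - a by ring] at this
    have hae : ¬ Even a := fun h => hbad ⟨h, hd2⟩
    have hbo : Odd (b : ℤ) := by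
      have := even_iff_two_dvd.2 (hpe.two_dvd.trans hd2)
      rw [← Int.not_even_iff_odd]
      exact fun h => hae ((Int.even_sub.1 this).1 h)
    rw [coeff_self hp hab hd, Int.negOnePow_odd _ hbo] at key
    apply h2
    nth_rewrite 1 [key]
    simp
  · rwa [coeff_eq_zero_of_not_dvd hd, zero_smul] at key

/-- Modulo the Adem relations, every product of two generators is a combination of the products
`e_a e_b` with `0 ≤ a ≤ b`, `a` even and `a ≡ b` modulo `p - 1`. -/
theorem mul_mem_span_basis {k : Type*} [Ring k] [Module k R] (hp : 1 < p) (hodd : Odd p)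
    (h2 : ∀ x : R, x + x = 0 → x = 0) (he : ∀ n < 0, e n = 0)
    (hrel : ∀ i j, 0 ≤ i → 0 ≤ j → e i * e j = theta p e i j) (i j : ℤ) :
    e i * e j ∈ Submodule.span k
      {x | ∃ a b : ℤ, 0 ≤ a ∧ a ≤ b ∧ IsBasisParity p a b ∧ x = e a * e b} := by
  have hle : ∀ a b : ℤ, a ≤ b → e a * e b ∈ Submodule.span k
      {x | ∃ a b : ℤ, 0 ≤ a ∧ a ≤ b ∧ IsBasisParity p a b ∧ x = e a * e b} := by
    intro a b hab
    rcases lt_or_ge a 0 with h | h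
    · rw [he a h, zero_mul]; exact zero_mem _
    · by_cases hg : IsBasisParity p a b
      · exact Submodule.subset_span ⟨a, b, h, hab, hg, rfl⟩
      · lift b to ℕ using h.trans hab
        rw [mul_eq_zero_of_not_isBasisParity hp hodd h2 he hrel b a h hab hg]
        exact zero_mem _
  rcases le_or_gt i j with hij | hij
  · exact hle i j hij
  rcases lt_or_ge j 0 with h | h
  · rw [he j h, mul_zero]; exact zero_mem _
  rw [hrel i j (h.trans hij.le) h, theta]
  refine Submodule.sum_mem _ fun l _ => ?_
  by_cases hlt : (p : ℤ) * l < i + ((p : ℤ) - 1) * j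
  · rw [coeff_eq_zero_of_lt hp hlt, zero_smul]; exact zero_mem _
  have hp1 : (1 : ℤ) < p := by exact_mod_cast hp
  exact zsmul_mem (hle _ _ (by nlinarith)) _

end Adem

open PowerSeries

/-! ### Powers of `1 - X ^ (p - 1)` with integer exponents -/

/-- The power series `(1 - X ^ d) ^ z` with an integer exponent `z`. -/
noncomputable def oneSubPow (A : Type*) [CommRing A] (d : ℕ) (hd : d ≠ 0) (z : ℤ) : A⟦X⟧ :=
  expand d hd (rescale (-1 : A) (binomialSeries A z))

section
variable {A : Type*} [CommRing A] {d : ℕ} (hd : d ≠ 0)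

theorem oneSubPow_add (z w : ℤ) :
    oneSubPow A d hd (z + w) = oneSubPow A d hd z * oneSubPow A d hd w := by
  simp [oneSubPow]

theorem oneSubPow_natCast (n : ℕ) : oneSubPow A d hd n = (1 - X ^ d) ^ n := by
  simp [oneSubPow, rescale_X, sub_eq_add_neg]

theorem coeff_oneSubPow_mul (z : ℤ) (l : ℕ) :
    PowerSeries.coeff (d * l) (oneSubPow A d hd z) = (((-1) ^ l * Ring.choose z l : ℤ) : A) := by
  simp [oneSubPow, coeff_expand_mul, coeff_rescale]

theorem coeff_oneSubPow_of_not_dvd (z : ℤ) {n : ℕ} (h : ¬ d ∣ n) :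
    PowerSeries.coeff n (oneSubPow A d hd z) = 0 := by
  rw [oneSubPow, coeff_expand_of_not_dvd _ _ _ h]

theorem coeff_zero_oneSubPow (z : ℤ) : PowerSeries.coeff 0 (oneSubPow A d hd z) = 1 := by
  simpa using coeff_oneSubPow_mul (A := A) hd z 0

end

theorem dvd_choose_mul_self (p : ℕ) {l : ℕ} (hl : l ≠ 0) : p ∣ (p * l).choose l := by
  obtain ⟨l, rfl⟩ : ∃ m, l = m + 1 := ⟨l - 1, by omega⟩
  rcases Nat.eq_zero_or_pos p with rfl | hp
  · simp
  have h := Nat.add_one_mul_choose_eq (p * (l + 1) - 1) l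
  rw [Nat.sub_add_cancel (Nat.mul_pos hp l.succ_pos)] at h
  refine ⟨(p * (l + 1) - 1).choose l, Nat.eq_of_mul_eq_mul_right l.succ_pos ?_⟩
  rw [← h]
  ring

/-- In characteristic `p`, the coefficient of `X ^ n` in `(1 - X ^ (p - 1)) ^ (- n - 1)` vanishes
for `n > 0`. It expresses that `V = X ^ p - X` has derivative `-1`, so that the residues of
`V ^ b V ^ (- j - 1) dV` are those of a monomial. -/
theorem coeff_oneSubPow_neg {A : Type*} [CommRing A] {p : ℕ} [CharP A p] (hp : p - 1 ≠ 0) {n : ℕ}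
    (hn : n ≠ 0) : PowerSeries.coeff n (oneSubPow A (p - 1) hp (-n - 1)) = 0 := by
  by_cases hd : p - 1 ∣ n
  · obtain ⟨l, rfl⟩ := hd
    rw [coeff_oneSubPow_mul, Int.cast_mul]
    have h1 : (-((p - 1) * l : ℕ) - 1 : ℤ) = -(((p - 1) * l : ℕ) + 1 : ℤ) := by ring
    have h2 : (((p - 1) * l : ℕ) + 1 + l - 1 : ℤ) = ((p * l : ℕ) : ℤ) := by
      obtain ⟨q, rfl⟩ : ∃ q, p = q + 1 := ⟨p - 1, by omega⟩
      simp only [Nat.add_sub_cancel]; push_cast; ring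
    rw [h1, Ring.choose_neg, h2, Ring.choose_natCast]
    have h3 : (((p * l).choose l : ℕ) : A) = 0 :=
      (CharP.cast_eq_zero_iff A p _).2 (dvd_choose_mul_self p (by rintro rfl; simp at hn))
    simp [Units.smul_def, h3]
  · exact coeff_oneSubPow_of_not_dvd hp _ hd

/-- Extraction of the coefficient of `V ^ j` from a polynomial in `V = X ^ p - X`. -/
theorem coeff_pow_mul_oneSubPow {A : Type*} [CommRing A] {p : ℕ} [CharP A p] (hp : p - 1 ≠ 0)
    (b j : ℕ) :
    PowerSeries.coeff j ((X ^ p - X) ^ b * oneSubPow A (p - 1) hp (-j - 1)) =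
      if b = j then (-1) ^ j else 0 := by
  have h1 : (X ^ p - X : A⟦X⟧) ^ b =
      (PowerSeries.C (-1) ^ b) * (X ^ b * oneSubPow A (p - 1) hp b) := by
    rw [oneSubPow_natCast, ← mul_pow, ← mul_pow]
    congr 1
    obtain ⟨q, rfl⟩ : ∃ q, p = q + 1 := ⟨p - 1, by omega⟩
    simp; ring
  rw [h1, mul_assoc, mul_assoc, ← oneSubPow_add, ← map_pow, PowerSeries.coeff_C_mul]
  rcases lt_trichotomy b j with h | rfl | h
  · obtain ⟨n, rfl⟩ := Nat.exists_eq_add_of_lt h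
    rw [show b + n + 1 = (n + 1) + b by ring, coeff_X_pow_mul,
      show (b : ℤ) + (-((n + 1 + b : ℕ) : ℤ) - 1) = -((n + 1 : ℕ) : ℤ) - 1 by push_cast; ring,
      coeff_oneSubPow_neg hp (by omega), if_neg (by omega), mul_zero]
  · rw [if_pos rfl, coeff_X_pow_mul']
    simp [coeff_zero_oneSubPow]
  · rw [coeff_X_pow_mul', if_neg (by omega), if_neg (by omega), mul_zero]

/-- The coefficients of the relation indexed by `(N - p j, j)`, up to the sign `(-1) ^ j`, as the
coefficients of `X ^ j` in the series `X ^ (N - p b) (1 - X ^ (p - 1)) ^ (b - j - 1)`. -/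
theorem coeff_X_pow_mul_oneSubPow {A : Type*} [CommRing A] {p : ℕ} (hp : p - 1 ≠ 0)
    {N b j : ℕ} (hb : p * b ≤ N) :
    PowerSeries.coeff j (X ^ (N - p * b) * oneSubPow A (p - 1) hp (b - j - 1)) =
      (-1) ^ j * ((KudoArakiMay.coeff p (N - p * j) j b : ℤ) : A) := by
  have hp1 : ((p - 1 : ℕ) : ℤ) = (p : ℤ) - 1 := by omega
  have hnum : (p * b - (N - p * j) : ℤ) = ((p : ℤ) - 1) * j + (j - (N - p * b : ℕ)) := by
    rw [Nat.cast_sub hb]; push_cast; ring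
  rw [coeff_X_pow_mul']
  split_ifs with h
  · obtain ⟨n, hn⟩ := Nat.exists_eq_add_of_le h
    rw [hn, Nat.add_sub_cancel_left]
    by_cases hd : p - 1 ∣ n
    · obtain ⟨l, rfl⟩ := hd
      have hnum' : (p * b - (N - p * j) : ℤ) = ((p : ℤ) - 1) * (j + l) := by
        rw [hnum]; conv_lhs => rw [mul_comm]
        rw [mul_add, ← hp1]; push_cast [hn]; ring
      rw [← hn, coeff_oneSubPow_mul, coeff_eq_of_eq_mul (by omega) hnum', binom,
        if_pos (by omega), show ((j : ℤ) + l - j).toNat = l by omega, Int.negOnePow_add]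
      push_cast
      rw [← mul_assoc, ← mul_assoc]
      congr 1
      simp [← mul_pow]
    · rw [coeff_oneSubPow_of_not_dvd _ _ hd, coeff_eq_zero_of_not_dvd]
      · simp
      · rw [← hn, hnum, dvd_add_right (dvd_mul_right _ _), ← hp1, hn]
        push_cast
        rw [add_sub_cancel_left]
        exact_mod_cast hd
  · rw [coeff_eq_zero_of_lt (by omega)]
    · simp
    · have : (j : ℤ) < (N - p * b : ℕ) := by omega
      linarith

/-- If the polynomials `∑ c_b V ^ b` for `V = X ^ p - X` and
`∑ c_b X ^ (N - p b) (1 - X ^ (p - 1)) ^ b` agree, then their coefficients satisfy the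
relations of weight `N`. -/
theorem eq_sum_coeff_of_sum_pow_eq {A : Type*} [CommRing A] {p : ℕ} [CharP A p] (hp : p - 1 ≠ 0)
    (N : ℕ) (c : ℕ → A)
    (h : ∑ b ∈ Finset.range (N / p + 1), PowerSeries.C (c b) * (X ^ p - X) ^ b =
      ∑ b ∈ Finset.range (N / p + 1),
        PowerSeries.C (c b) * (X ^ (N - p * b) * (1 - X ^ (p - 1)) ^ b)) (j : ℕ) :
    (if j ≤ N / p then c j else 0) =
      ∑ b ∈ Finset.range (N / p + 1), KudoArakiMay.coeff p (N - p * j) j b • c b := by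
  have hs : ((-1) ^ j * (-1) ^ j : A) = 1 := by rw [← mul_pow]; simp
  have h1 := congrArg
    (fun f => (-1) ^ j * PowerSeries.coeff j (f * oneSubPow A (p - 1) hp (-j - 1))) h
  simp only [Finset.sum_mul, map_sum, mul_assoc, PowerSeries.coeff_C_mul] at h1
  rw [Finset.mul_sum, Finset.mul_sum] at h1
  convert h1 using 1
  · rw [Finset.sum_congr rfl fun b _ => by rw [coeff_pow_mul_oneSubPow hp b j]]
    simp only [mul_ite, mul_zero, Finset.sum_ite_eq', Finset.mem_range]
    split_ifs
    · rw [mul_left_comm, hs, mul_one]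
    · omega
    · omega
    · rfl
  · refine Finset.sum_congr rfl fun b hb => ?_
    have hb' : p * b ≤ N := by
      rw [mul_comm]
      exact (Nat.le_div_iff_mul_le (by omega)).1 (Nat.lt_succ_iff.1 (Finset.mem_range.1 hb))
    rw [← oneSubPow_natCast hp, ← oneSubPow_add, ← add_sub_assoc, ← sub_eq_add_neg,
      coeff_X_pow_mul_oneSubPow hp hb', zsmul_eq_mul]
    linear_combination (-(KudoArakiMay.coeff p (N - p * j) j b : A) * c b) * hs

/-! ### Operations on a polynomial algebra -/

/-- The polynomial algebra over `𝔽_p` on a generator `t = X none` and generators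
`y_{k,n} = X (some (k, n))`. -/
abbrev RepAlg (p : ℕ) : Type := MvPolynomial (Option (ℕ × ℕ)) (ZMod p)

/-- The total operation `f ↦ ∑ e_i(f) u ^ i`, the homomorphism of algebras with `t ↦ t u ^ r` and
`y_{k,n} ↦ y_{k,n+1} + y_{k,n} u ^ ((p - 1) p ^ n)`. The variables `y_{k,n}` behave like the powers
`x ^ (p ^ n)` of an element `x` with `x ↦ x ^ p + u ^ (p - 1) x`. The twofold iterate multiplies `t`
by the `r`-th power of `u V = u v ^ p - u ^ p v`, which changes its sign under the exchange of `u`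
and `v`. -/
noncomputable def totalOp (p r : ℕ) : RepAlg p →ₐ[ZMod p] Polynomial (RepAlg p) :=
  MvPolynomial.aeval fun s => match s with
    | none => Polynomial.C (MvPolynomial.X none) * Polynomial.X ^ r
    | some (k, n) => Polynomial.C (MvPolynomial.X (some (k, n + 1))) +
        Polynomial.C (MvPolynomial.X (some (k, n))) * Polynomial.X ^ ((p - 1) * p ^ n)

/-- The operation `e_i`, the coefficient of `u ^ i` in the total operation, and zero for
`i < 0`. -/
noncomputable def op (p r : ℕ) (i : ℤ) : Module.End (ZMod p) (RepAlg p) :=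
  if 0 ≤ i then
    (Polynomial.lcoeff (RepAlg p) i.toNat).restrictScalars (ZMod p) ∘ₗ (totalOp p r).toLinearMap
  else 0

section
variable {p r : ℕ}

@[simp]
theorem totalOp_X_none : totalOp p r (MvPolynomial.X none) =
    Polynomial.C (MvPolynomial.X none) * Polynomial.X ^ r := by
  simp [totalOp]

@[simp]
theorem totalOp_X_some (k n : ℕ) : totalOp p r (MvPolynomial.X (some (k, n))) =
    Polynomial.C (MvPolynomial.X (some (k, n + 1))) +
        Polynomial.C (MvPolynomial.X (some (k, n))) * Polynomial.X ^ ((p - 1) * p ^ n) := by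
  simp [totalOp]

theorem op_natCast_apply (i : ℕ) (f : RepAlg p) : op p r i f = (totalOp p r f).coeff i := by
  simp [op]

theorem op_of_neg {i : ℤ} (hi : i < 0) : op p r i = 0 := if_neg (not_le.2 hi)

/-- The total operation is a polynomial in `u ^ r`. -/
theorem op_eq_zero_of_not_dvd (hr : r ≠ 0) (hrp : r ∣ p - 1) {i : ℤ} (hi : ¬ (r : ℤ) ∣ i) :
    op p r i = 0 := by
  rcases lt_or_ge i 0 with h | h
  · exact op_of_neg h
  lift i to ℕ using h
  obtain ⟨q, hq⟩ := hrp
  have key : totalOp p r = ((Polynomial.expand (RepAlg p) r).restrictScalars (ZMod p)).comp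
      (MvPolynomial.aeval fun s => match s with
        | none => Polynomial.C (MvPolynomial.X none) * Polynomial.X
        | some (k, n) => Polynomial.C (MvPolynomial.X (some (k, n + 1))) +
            Polynomial.C (MvPolynomial.X (some (k, n))) * Polynomial.X ^ (q * p ^ n)) := by
    apply MvPolynomial.algHom_ext
    rintro (_ | ⟨k, n⟩)
    · simp
    · simp [← pow_mul, hq, mul_assoc]
  refine LinearMap.ext fun f => ?_
  rw [op_natCast_apply, key, LinearMap.zero_apply, AlgHom.comp_apply,
    AlgHom.restrictScalars_apply, Polynomial.coeff_expand (Nat.pos_of_ne_zero hr), if_neg]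
  exact_mod_cast hi

end

/-! ### The operations satisfy the full relations -/

section
variable {A B : Type*} [CommRing A] [CommRing B]

theorem coeff_eval₂_C_mul_X (f : A →+* B) (a : B) (q : Polynomial A) (n : ℕ) :
    (q.eval₂ (Polynomial.C.comp f) (Polynomial.C a * Polynomial.X)).coeff n =
      f (q.coeff n) * a ^ n := by
  induction q using Polynomial.induction_on' with
  | add q q' h h' => simp [Polynomial.eval₂_add, h, h', add_mul]
  | monomial m x =>
    rw [Polynomial.eval₂_monomial, mul_pow, ← map_pow, RingHom.comp_apply, ← mul_assoc, ← map_mul,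
      Polynomial.coeff_C_mul_X_pow, Polynomial.coeff_monomial]
    by_cases h : n = m
    · subst h; simp
    · simp [h, Ne.symm h]

theorem coeff_eval₂_C_mul_X_pow {p : ℕ} (hp : 0 < p) (g : A →+* Polynomial B) (b : B)
    (q : Polynomial A) (N : ℕ) :
    (q.eval₂ g (Polynomial.C b * Polynomial.X ^ p)).coeff N =
      ∑ l ∈ Finset.range (N / p + 1), (g (q.coeff l)).coeff (N - p * l) * b ^ l := by
  induction q using Polynomial.induction_on' with
  | add q q' h h' => simp [Polynomial.eval₂_add, h, h', add_mul, Finset.sum_add_distrib]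
  | monomial m x =>
    rw [Polynomial.eval₂_monomial, mul_pow, ← map_pow, ← pow_mul, ← mul_assoc,
      Polynomial.coeff_mul_X_pow']
    have h1 : ∀ l, (g ((Polynomial.monomial m x).coeff l)).coeff (N - p * l) * b ^ l =
        if l = m then (g x).coeff (N - p * m) * b ^ m else 0 := by
      intro l
      by_cases h : l = m
      · subst h; simp
      · simp [h, Polynomial.coeff_monomial, Ne.symm h]
    simp only [h1, Finset.sum_ite_eq', Finset.mem_range, Nat.lt_succ_iff, Nat.le_div_iff_mul_le hp,
      mul_comm m p, Polynomial.coeff_mul_C]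

/-- The identity `1 + (x ^ p - x) ^ (p - 1) = x ^ (p (p - 1)) + (1 - x ^ (p - 1)) ^ (p - 1)`
underlying the symmetry of the iterated total operation. -/
theorem one_add_pow_sub_pow {p : ℕ} [Fact p.Prime] (hp : p ≠ 2) [CharP A p] (x : A) :
    1 + (x ^ p - x) ^ (p - 1) = x ^ ((p - 1) * p) + (1 - x ^ (p - 1)) ^ (p - 1) := by
  have hpp : p.Prime := Fact.out
  have heven : Even (p - 1) := hpp.even_sub_one hp
  obtain ⟨q, hq⟩ : ∃ q, p = q + 1 := ⟨p - 1, by have := hpp.pos; omega⟩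
  have h1 : (x ^ p - x) = x * (x ^ (p - 1) - 1) := by
    rw [hq]; simp only [Nat.add_sub_cancel]; ring
  have h2 : (1 - x ^ (p - 1)) ^ (p - 1) = (x ^ (p - 1) - 1) ^ (p - 1) := by
    rw [← heven.neg_pow, neg_sub]
  have h3 : (x ^ (p - 1) - 1) ^ (p - 1) * (x ^ (p - 1) - 1) = x ^ ((p - 1) * p) - 1 := by
    rw [← pow_succ, Nat.sub_add_cancel hpp.pos, sub_pow_char, one_pow, pow_mul]
  rw [h1, mul_pow, h2]
  linear_combination h3

theorem symm_prod {p : ℕ} (hp : 0 < p) (x h : A) {m : ℕ} (hm : Even m) :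
    h ^ m * ((x ^ p - x) * h ^ p) ^ m = (x * h) ^ m * ((1 - x ^ (p - 1)) * h ^ p) ^ m := by
  rw [← mul_pow, ← mul_pow, ← hm.neg_pow]
  congr 1
  obtain ⟨q, rfl⟩ : ∃ q, p = q + 1 := ⟨p - 1, by omega⟩
  simp only [Nat.add_sub_cancel]
  ring

theorem symm_sum {p : ℕ} [Fact p.Prime] (hp : p ≠ 2) [CharP A p] (x h : A) (n : ℕ) :
    h ^ ((p - 1) * p ^ (n + 1)) + ((x ^ p - x) * h ^ p) ^ ((p - 1) * p ^ n) =
      (x * h) ^ ((p - 1) * p ^ (n + 1)) +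
        ((1 - x ^ (p - 1)) * h ^ p) ^ ((p - 1) * p ^ n) := by
  rw [pow_succ', ← mul_assoc]
  simp only [pow_mul _ _ (p ^ n)]
  rw [← add_pow_char_pow, ← add_pow_char_pow]
  congr 1
  simp only [mul_pow, ← pow_mul, mul_comm p (p - 1), ← add_mul]
  rw [← one_add_pow_sub_pow hp]
  ring

theorem add_mul_add_eq {a b a' b' c c' : A} (h1 : c + b = c' + b') (h2 : a * b = a' * b')
    (y₀ y₁ y₂ : A) :
    y₂ + y₁ * c + (y₁ + y₀ * a) * b = y₂ + y₁ * c' + (y₁ + y₀ * a') * b' := by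
  linear_combination y₁ * h1 + y₀ * h2

end

section
variable {p r : ℕ}

/-- The iterated total operation `∑ e_a(e_b(f)) u ^ a V ^ b` with `u = α h` and `V = β h ^ p`,
where `h` is the polynomial variable, which records the weight `a + p b`. -/
noncomputable def iteratedOp (p r : ℕ) (α β : PowerSeries (RepAlg p)) :
    RepAlg p →+* Polynomial (PowerSeries (RepAlg p)) :=
  (Polynomial.eval₂RingHom ((Polynomial.eval₂RingHom (Polynomial.C.comp PowerSeries.C)
    (Polynomial.C α * Polynomial.X)).comp (totalOp p r : RepAlg p →+* Polynomial (RepAlg p)))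
    (Polynomial.C β * Polynomial.X ^ p)).comp (totalOp p r : RepAlg p →+* Polynomial (RepAlg p))

theorem coeff_iteratedOp (hp : 0 < p) (α β : PowerSeries (RepAlg p)) (f : RepAlg p) (N : ℕ) :
    (iteratedOp p r α β f).coeff N = ∑ b ∈ Finset.range (N / p + 1),
      PowerSeries.C (op p r (N - p * b : ℕ) (op p r b f)) * (α ^ (N - p * b) * β ^ b) := by
  simp only [iteratedOp, RingHom.comp_apply, Polynomial.coe_eval₂RingHom]
  rw [coeff_eval₂_C_mul_X_pow hp]
  refine Finset.sum_congr rfl fun b _ => ?_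
  simp only [RingHom.comp_apply, Polynomial.coe_eval₂RingHom]
  rw [coeff_eval₂_C_mul_X, op_natCast_apply, op_natCast_apply, mul_assoc]
  rfl

/-- Symmetry of the iterated total operation under the exchange of `(u, v) = (h, x h)` and
`(x h, h)`, where `V = v ^ p - u ^ (p - 1) v`. -/
theorem iteratedOp_symm [Fact p.Prime] (hp : p ≠ 2) (hr : Even r) :
    iteratedOp p r 1 (PowerSeries.X ^ p - PowerSeries.X) =
      iteratedOp p r PowerSeries.X (1 - PowerSeries.X ^ (p - 1)) := by
  have hpp : p.Prime := Fact.out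
  have heven : Even (p - 1) := hpp.even_sub_one hp
  have : CharP (PowerSeries (RepAlg p)) p :=
    charP_of_injective_ringHom PowerSeries.C_injective p
  have : CharP (Polynomial (PowerSeries (RepAlg p))) p :=
    charP_of_injective_ringHom Polynomial.C_injective p
  apply MvPolynomial.ringHom_ext
  · intro a
    simp only [iteratedOp, RingHom.comp_apply, RingHom.coe_coe, ← MvPolynomial.algebraMap_eq,
      AlgHom.commutes, Polynomial.algebraMap_apply, Polynomial.coe_eval₂RingHom,
      Polynomial.eval₂_C]
  · rintro (_ | ⟨k, n⟩)
    · simp only [iteratedOp, RingHom.comp_apply, RingHom.coe_coe, totalOp_X_none,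
        Polynomial.coe_eval₂RingHom, Polynomial.eval₂_mul, Polynomial.eval₂_C, Polynomial.eval₂_X,
        Polynomial.eval₂_pow, map_one, map_sub, map_pow, one_mul]
      rw [mul_assoc, mul_assoc, symm_prod hpp.pos _ _ hr]
    · simp only [iteratedOp, RingHom.comp_apply, RingHom.coe_coe, totalOp_X_some,
        Polynomial.coe_eval₂RingHom, Polynomial.eval₂_mul, Polynomial.eval₂_C, Polynomial.eval₂_X,
        Polynomial.eval₂_pow, Polynomial.eval₂_add, map_one, map_sub, map_pow, one_mul]
      have h1 := symm_sum hp (Polynomial.C PowerSeries.X)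
        (Polynomial.X : Polynomial (PowerSeries (RepAlg p))) n
      have h2 := symm_prod hpp.pos (Polynomial.C PowerSeries.X)
        (Polynomial.X : Polynomial (PowerSeries (RepAlg p))) (heven.mul_right (p ^ n))
      generalize Polynomial.C (PowerSeries.X : PowerSeries (RepAlg p)) = x at h1 h2 ⊢
      exact add_mul_add_eq h1 h2 _ _ _

/-- The operations satisfy the full relations. -/
theorem op_mul_op [Fact p.Prime] (hp : p ≠ 2) (hr : Even r) (i j : ℤ) :
    op p r i * op p r j = theta p (op p r) i j := by
  have hpp : p.Prime := Fact.out
  have hp1 : 1 < p := hpp.one_lt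
  rcases lt_or_ge j 0 with hj | hj
  · rw [theta_eq_zero_of_right_neg hp1 _ hj, op_of_neg hj, mul_zero]
  lift j to ℕ using hj
  rcases lt_or_ge (i + p * j) 0 with hN | hN
  · have hi : i < 0 := by
      have : (0 : ℤ) ≤ p * j := by positivity
      omega
    rw [op_of_neg hi, zero_mul, theta, Finset.Icc_eq_empty, Finset.sum_empty]
    rw [not_le]
    exact Int.ediv_neg_of_neg_of_pos hN (by omega)
  obtain ⟨N, hN'⟩ := Int.eq_ofNat_of_zero_le hN
  obtain rfl : i = N - p * j := by omega
  refine LinearMap.ext fun f => ?_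
  have h := congrArg (fun q => (q f).coeff N) (iteratedOp_symm (p := p) (r := r) hp hr)
  simp only [coeff_iteratedOp hpp.pos, one_pow, one_mul] at h
  have h' := eq_sum_coeff_of_sum_pow_eq (p := p) (by omega) N
    (fun b => op p r (N - p * b : ℕ) (op p r b f)) h j
  have hcast : ∀ b : ℕ, b ≤ N / p → ((N - p * b : ℕ) : ℤ) = N - p * b := by
    intro b hb
    rw [Nat.cast_sub]
    · push_cast; rfl
    · rw [mul_comm]; exact (Nat.le_div_iff_mul_le hpp.pos).1 hb
  have hleft : (op p r (N - p * j) * op p r j) f =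
      if j ≤ N / p then op p r (N - p * j : ℕ) (op p r j f) else 0 := by
    split_ifs with hjN
    · rw [hcast j hjN]; rfl
    · rw [op_of_neg, zero_mul, LinearMap.zero_apply]
      rw [Nat.le_div_iff_mul_le hpp.pos] at hjN
      push Not at hjN
      rw [mul_comm] at hjN
      have : (N : ℤ) < p * j := by exact_mod_cast hjN
      omega
  rw [hleft, h', theta, sub_add_cancel, LinearMap.sum_apply]
  symm
  refine Finset.sum_nbij' (fun k => k.toNat) (fun b => (b : ℤ)) ?_ ?_ ?_ ?_ ?_
  · intro k hk
    rw [Finset.mem_Icc] at hk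
    rw [Finset.mem_range]
    have h2 := hk.2
    rw [← Int.natCast_div] at h2
    omega
  · intro b hb
    rw [Finset.mem_range] at hb
    rw [Finset.mem_Icc, ← Int.natCast_div]
    omega
  · intro k hk
    exact Int.toNat_of_nonneg (Finset.mem_Icc.1 hk).1
  · intro b _
    simp
  · intro k hk
    rw [Finset.mem_Icc, ← Int.natCast_div] at hk
    have hk' : ((k.toNat : ℕ) : ℤ) = k := Int.toNat_of_nonneg hk.1
    rw [hcast _ (by omega), hk']
    rfl

end

/-! ### Linear independence of the basis words -/

section
variable {p r : ℕ}

/-- The evaluation `y_{k,n} ↦ z_k` for `n = max (k + 1 - m, 0)`, `y_{k,n} ↦ 0` for the other `n`,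
and `t ↦ z`, where `z = X none` and `z_k = X (some k)`. -/
noncomputable def evalAt (p m : ℕ) : RepAlg p →ₐ[ZMod p] MvPolynomial (Option ℕ) (ZMod p) :=
  MvPolynomial.aeval fun s => match s with
    | none => MvPolynomial.X none
    | some (k, n) => if n = k + 1 - m then MvPolynomial.X (some k) else 0

@[simp]
theorem evalAt_X_none (m : ℕ) : evalAt p m (MvPolynomial.X none) = MvPolynomial.X none := by
  simp [evalAt]

@[simp]
theorem evalAt_X_some (m k n : ℕ) : evalAt p m (MvPolynomial.X (some (k, n))) =
    if n = k + 1 - m then MvPolynomial.X (some k) else 0 := by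
  simp [evalAt]

/-- The weights of the variables `z` and `z_k` at the stage `m`: the lowest power of `u` with which
the variable occurs in the evaluated total operation. -/
def stageWeight (p r m : ℕ) : Option ℕ → ℕ
  | none => r
  | some k => if k < m then p - 1 else 0

/-- The substitution `z_s ↦ z_s u ^ w(s)` on polynomials in `u`. -/
noncomputable def scaleVars (p : ℕ) (w : Option ℕ → ℕ) :
    Polynomial (MvPolynomial (Option ℕ) (ZMod p)) →+*
      Polynomial (MvPolynomial (Option ℕ) (ZMod p)) :=
  Polynomial.eval₂RingHom
    ((MvPolynomial.aeval fun s => Polynomial.C (MvPolynomial.X s) * Polynomial.X ^ w s :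
      MvPolynomial (Option ℕ) (ZMod p) →ₐ[ZMod p] Polynomial (MvPolynomial (Option ℕ) (ZMod p))) :
      MvPolynomial (Option ℕ) (ZMod p) →+* _) Polynomial.X

theorem scaleVars_C_monomial (w : Option ℕ → ℕ) (s : Option ℕ →₀ ℕ) (a : ZMod p) :
    scaleVars p w (Polynomial.C (MvPolynomial.monomial s a)) =
      Polynomial.C (MvPolynomial.monomial s a) * Polynomial.X ^ Finsupp.weight w s := by
  rw [scaleVars, Polynomial.coe_eval₂RingHom, Polynomial.eval₂_C, RingHom.coe_coe,
    MvPolynomial.aeval_monomial, MvPolynomial.monomial_eq]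
  simp only [mul_pow, map_mul, Finsupp.weight_apply, Finsupp.prod,
    Finsupp.sum, map_prod, map_pow, smul_eq_mul, ← pow_mul, mul_comm (w _)]
  rw [Finset.prod_mul_distrib, Finset.prod_pow_eq_pow_sum, mul_assoc]
  rfl

theorem coeff_coeff_scaleVars (w : Option ℕ → ℕ) (b : Option ℕ →₀ ℕ)
    (F : Polynomial (MvPolynomial (Option ℕ) (ZMod p))) (i : ℕ) :
    MvPolynomial.coeff b ((scaleVars p w F).coeff i) =
      if Finsupp.weight w b ≤ i then
        MvPolynomial.coeff b (F.coeff (i - Finsupp.weight w b)) else 0 := by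
  induction F using Polynomial.induction_on' with
  | add F G hF hG =>
    simp only [map_add, Polynomial.coeff_add, MvPolynomial.coeff_add, hF, hG]
    split_ifs <;> simp
  | monomial j x =>
    induction x using MvPolynomial.induction_on' with
    | add x y hx hy =>
      simp only [map_add, Polynomial.coeff_add, MvPolynomial.coeff_add, hx, hy]
      split_ifs <;> simp
    | monomial s a =>
      rw [← Polynomial.C_mul_X_pow_eq_monomial, map_mul, scaleVars_C_monomial, map_pow, mul_assoc]
      have hX : scaleVars p w Polynomial.X = Polynomial.X := by simp [scaleVars]
      rw [hX, ← pow_add, Polynomial.coeff_C_mul_X_pow, Polynomial.coeff_C_mul_X_pow]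
      by_cases hs : s = b
      · subst hs
        by_cases h1 : i = Finsupp.weight w s + j
        · simp [h1]
        · rw [if_neg h1]
          split_ifs <;> first | omega | simp
      · split_ifs <;> simp [MvPolynomial.coeff_monomial, hs]

/-- After the evaluation at the stage `m`, the coefficient of `z ^ b` in the total operation is
divisible by `u ^ c` for the weight `c` of `b`, and its lowest term is given by the evaluation at the
stage `m + 1`. The reason is that the total operation followed by the evaluation factors through the
substitution `z_s ↦ z_s u ^ w(s)`. -/
theorem coeff_evalAt_op (hp : p - 1 ≠ 0) (m : ℕ) (b : Option ℕ →₀ ℕ) (f : RepAlg p) {i : ℕ}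
    (hi : i ≤ Finsupp.weight (stageWeight p r m) b) :
    MvPolynomial.coeff b (evalAt p m (op p r i f)) =
      if i = Finsupp.weight (stageWeight p r m) b then
        MvPolynomial.coeff b (evalAt p (m + 1) f) else 0 := by
  have hp0 : p ≠ 0 := by rintro rfl; simp at hp
  set H : RepAlg p →ₐ[ZMod p] Polynomial (MvPolynomial (Option ℕ) (ZMod p)) :=
    (Polynomial.mapAlgHom (evalAt p m)).comp (totalOp p r) with hH
  have hHsome : ∀ k n, H (MvPolynomial.X (some (k, n))) =
      Polynomial.C (if n + 1 = k + 1 - m then MvPolynomial.X (some k) else 0) +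
      Polynomial.C (if n = k + 1 - m then MvPolynomial.X (some k) else 0) *
        Polynomial.X ^ ((p - 1) * p ^ n) := by
    intro k n
    simp [hH]
  set L : RepAlg p →ₐ[ZMod p] Polynomial (MvPolynomial (Option ℕ) (ZMod p)) :=
    MvPolynomial.aeval fun s => match s with
      | none => Polynomial.C (MvPolynomial.X none)
      | some (k, n) => if k < m then
          Polynomial.C (if n = 0 then MvPolynomial.X (some k) else 0)
        else H (MvPolynomial.X (some (k, n))) with hL
  have hscale : ∀ s, scaleVars p (stageWeight p r m) (Polynomial.C (MvPolynomial.X s)) =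
      Polynomial.C (MvPolynomial.X s) * Polynomial.X ^ stageWeight p r m s := by
    intro s
    simp [scaleVars]
  have hscaleX : scaleVars p (stageWeight p r m) Polynomial.X = Polynomial.X := by
    simp [scaleVars]
  -- The factor `L` is what remains of `H` when `z_s` is divided by `u ^ w(s)`.
  have hfac : (H : RepAlg p →+* _) =
      (scaleVars p (stageWeight p r m)).comp (L : RepAlg p →+* _) := by
    apply MvPolynomial.ringHom_ext
    · intro a
      simp [scaleVars, hH, hL, ← MvPolynomial.algebraMap_eq, Polynomial.algebraMap_apply]
    · rintro (_ | ⟨k, n⟩)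
      · simp [hH, hL, hscale, stageWeight]
      · rw [RingHom.comp_apply, RingHom.coe_coe, RingHom.coe_coe, hL, MvPolynomial.aeval_X]
        by_cases hk : k < m
        · simp only [hHsome, hk, if_true, show k + 1 - m = 0 by omega, Nat.add_eq_zero_iff]
          by_cases hn : n = 0
          · simp [hn, hscale, stageWeight, hk]
          · simp [hn]
        · simp only [hHsome, hk, if_false]
          have hC : ∀ q : Prop, [Decidable q] → scaleVars p (stageWeight p r m)
              (Polynomial.C (if q then MvPolynomial.X (some k) else 0)) =
              Polynomial.C (if q then MvPolynomial.X (some k) else 0) := by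
            intro q _
            split_ifs
            · simp [hscale, stageWeight, hk]
            · simp
          simp only [map_add, map_mul, map_pow, hscaleX, hC]
  have hconst : Polynomial.constantCoeff.comp (L : RepAlg p →+* _) =
      (evalAt p (m + 1) : RepAlg p →+* MvPolynomial (Option ℕ) (ZMod p)) := by
    apply MvPolynomial.ringHom_ext
    · intro a
      simp [hL, ← MvPolynomial.algebraMap_eq, Polynomial.algebraMap_apply]
    · rintro (_ | ⟨k, n⟩)
      · simp [hL]
      · rw [RingHom.comp_apply, RingHom.coe_coe, RingHom.coe_coe, hL, MvPolynomial.aeval_X]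
        by_cases hk : k < m
        · simp [hk, show k + 1 - (m + 1) = 0 by omega]
        · simp only [hHsome, hk, if_false]
          have : (n + 1 = k + 1 - m) ↔ n = k + 1 - (m + 1) := by omega
          simp [this, hp, hp0, Polynomial.coeff_X_pow]
  have h1 : evalAt p m (op p r i f) = (scaleVars p (stageWeight p r m) (L f)).coeff i := by
    have h2 := congrArg (fun q => Polynomial.coeff (q f) i) hfac
    simp only [RingHom.coe_coe, RingHom.comp_apply] at h2
    rw [← h2, hH, op_natCast_apply]
    simp
  rw [h1, coeff_coeff_scaleVars]
  have h3 := congrArg (fun q => q f) hconst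
  simp only [RingHom.coe_coe, RingHom.comp_apply, Polynomial.constantCoeff_apply] at h3
  rw [← h3]
  rcases hi.eq_or_lt with h | h
  · rw [if_pos h.ge, if_pos h, h, Nat.sub_self]
  · rw [if_neg (by omega), if_neg (by omega)]

/-- The coefficient of `z ^ b` in the evaluation of a word of operations vanishes for words of the
same length which are lexicographically smaller than the word of the successive weights of `b`. For
the latter word it is computed by the evaluation at the last stage. -/
theorem coeff_evalAt_prod_op (hp : p - 1 ≠ 0) (b : Option ℕ →₀ ℕ) (f : RepAlg p) (v : List ℕ) :
    ∀ (v' : List ℕ) (m : ℕ), v'.length = v.length → v' ≤ v →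
      (∀ (l : ℕ) (h : l < v.length), v[l] = Finsupp.weight (stageWeight p r (m + l)) b) →
      MvPolynomial.coeff b (evalAt p m ((v'.map fun i : ℕ => op p r i).prod f)) =
        if v' = v then MvPolynomial.coeff b (evalAt p (m + v.length) f) else 0 := by
  induction v with
  | nil =>
    intro v' m hlen _ _
    rw [List.length_nil, List.length_eq_zero_iff] at hlen
    simp [hlen]
  | cons i v ih =>
    rintro (_ | ⟨i', v'⟩) m hlen hle hw
    · simp at hlen
    have h0 : i = Finsupp.weight (stageWeight p r m) b := hw 0 (by simp)
    have hi : i' ≤ i := by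
      rcases hle.eq_or_lt with h | h
      · simp only [List.cons.injEq] at h; omega
      · rw [List.cons_lt_cons_iff] at h; omega
    rw [List.map_cons, List.prod_cons, Module.End.mul_apply, coeff_evalAt_op hp _ _ _ (h0 ▸ hi),
      ← h0]
    by_cases hii : i' = i
    · subst hii
      have hle' : v' ≤ v := by
        rcases hle.eq_or_lt with h | h
        · simp only [List.cons.injEq] at h; exact h.2.le
        · rw [List.cons_lt_cons_iff] at h
          rcases h with h | h
          · exact absurd h (lt_irrefl _)
          · exact h.2.le
      rw [if_pos rfl, ih v' (m + 1) (by simpa using hlen) hle']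
      · simp [add_comm, add_left_comm]
      · intro l h
        have := hw (l + 1) (by simpa using h)
        rw [List.getElem_cons_succ] at this
        rw [this, add_right_comm, add_assoc]
    · rw [if_neg hii, if_neg]
      simp [hii]

/-- The words with entries divisible by `r` which are weakly increasing and constant modulo
`p - 1`. -/
def IsDivBasisWord (p r : ℕ) (w : List ℕ) : Prop :=
  (∀ i ∈ w, r ∣ i) ∧ w.IsChain fun a b => a ≤ b ∧ a ≡ b [MOD p - 1]

/-- The entries of a basis word are the successive weights of an exponent vector `b`: the exponent of
`z` comes from the first entry, that of `z_k` from the difference of two consecutive entries. There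
is an element `f` with coefficient one at `z ^ b` after the last stage, where `y_{k,0} ↦ z_k`. -/
theorem exists_weight_eq {w : List ℕ} (hw : IsDivBasisWord p r w) :
    ∃ (b : Option ℕ →₀ ℕ) (f : RepAlg p),
      (∀ (l : ℕ) (h : l < w.length), w[l] = Finsupp.weight (stageWeight p r l) b) ∧
      MvPolynomial.coeff b (evalAt p w.length f) = 1 := by
  set n := w.length with hn
  set β : ℕ → ℕ := fun k => (w.getD (k + 1) 0 - w.getD k 0) / (p - 1) with hβ
  set a := w.getD 0 0 / r with ha
  refine ⟨Finsupp.single none a + ∑ k ∈ Finset.range (n - 1), Finsupp.single (some k) (β k),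
    MvPolynomial.X none ^ a *
      ∏ k ∈ Finset.range (n - 1), MvPolynomial.X (some (k, 0)) ^ β k, ?_, ?_⟩
  · have hwt : ∀ l, Finsupp.weight (stageWeight p r l)
        (Finsupp.single none a + ∑ k ∈ Finset.range (n - 1), Finsupp.single (some k) (β k)) =
        a * r + ∑ k ∈ Finset.range (n - 1), if k < l then β k * (p - 1) else 0 := by
      intro l
      simp only [map_add, map_sum, Finsupp.weight_single, stageWeight, smul_eq_mul, mul_ite,
        mul_zero]
    intro l
    rw [hwt]
    induction l with
    | zero =>
      intro h
      have h1 : w.getD 0 0 = w[0] := List.getD_eq_getElem _ _ h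
      simp only [Nat.not_lt_zero, if_false, Finset.sum_const_zero, add_zero, ha, h1]
      exact (Nat.div_mul_cancel (hw.1 _ (List.getElem_mem h))).symm
    | succ l ih =>
      intro h
      have hl : l < w.length := by omega
      have hstep : ∀ k ∈ Finset.range (n - 1), (if k < l + 1 then β k * (p - 1) else 0) =
          (if k < l then β k * (p - 1) else 0) + if k = l then β k * (p - 1) else 0 := by
        intro k _
        rcases lt_trichotomy k l with hk | hk | hk
        · simp [hk, hk.trans (Nat.lt_succ_self l), hk.ne]
        · simp [hk]
        · simp [show ¬ k < l + 1 by omega, show ¬ k < l by omega, hk.ne']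
      rw [Finset.sum_congr rfl hstep, Finset.sum_add_distrib, ← add_assoc, ← ih hl,
        Finset.sum_ite_eq', if_pos (Finset.mem_range.2 (by omega))]
      have hc := List.isChain_iff_getElem.1 hw.2 l (by omega)
      have h1 : w.getD l 0 = w[l] := List.getD_eq_getElem _ _ hl
      have h2 : w.getD (l + 1) 0 = w[l + 1] := List.getD_eq_getElem _ _ (by omega)
      simp only [hβ, h1, h2]
      rw [Nat.div_mul_cancel ((Nat.modEq_iff_dvd' hc.1).1 hc.2)]
      omega
  · have h1 : evalAt p n (MvPolynomial.X none ^ a *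
        ∏ k ∈ Finset.range (n - 1), MvPolynomial.X (some (k, 0)) ^ β k) =
        MvPolynomial.X none ^ a * ∏ k ∈ Finset.range (n - 1), MvPolynomial.X (some k) ^ β k := by
      rw [map_mul, map_pow, map_prod, evalAt_X_none]
      congr 1
      refine Finset.prod_congr rfl fun k hk => ?_
      rw [Finset.mem_range] at hk
      rw [map_pow, evalAt_X_some, if_pos (by omega)]
    have h2 : MvPolynomial.X none ^ a *
        ∏ k ∈ Finset.range (n - 1), MvPolynomial.X (some k) ^ β k =
        MvPolynomial.monomial (Finsupp.single none a +
          ∑ k ∈ Finset.range (n - 1), Finsupp.single (some k) (β k)) (1 : ZMod p) := by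
      rw [← one_mul (1 : ZMod p), ← MvPolynomial.monomial_mul, MvPolynomial.monomial_sum_one]
      simp only [MvPolynomial.X_pow_eq_monomial]
    rw [h1, h2, MvPolynomial.coeff_monomial, if_pos rfl]

/-- Vectors on which a family of functionals is triangular are linearly independent. -/
theorem linearIndependent_of_triangular {K V ι : Type*} [Field K] [AddCommGroup V] [Module K V]
    [LinearOrder ι] {v : ι → V} (φ : ι → V →ₗ[K] K) (h0 : ∀ i j, j < i → φ i (v j) = 0)
    (h1 : ∀ i, φ i (v i) = 1) : LinearIndependent K v := by
  classical
  rw [linearIndependent_iff']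
  intro s g hg
  by_contra! hne
  obtain ⟨i, his, hi⟩ := hne
  have hfne : (s.filter fun i => g i ≠ 0).Nonempty := ⟨i, Finset.mem_filter.2 ⟨his, hi⟩⟩
  set m := (s.filter fun i => g i ≠ 0).max' hfne with hm
  have hmem := Finset.mem_filter.1 (Finset.max'_mem _ hfne)
  have h := congrArg (φ m) hg
  rw [map_sum, map_zero, Finset.sum_eq_single_of_mem m hmem.1] at h
  · rw [map_smul, h1, smul_eq_mul, mul_one] at h
    exact hmem.2 h
  · intro j hj hjm
    by_cases hgj : g j = 0
    · rw [hgj, zero_smul, map_zero]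
    · have : j ≤ m := Finset.le_max' _ _ (Finset.mem_filter.2 ⟨hj, hgj⟩)
      rw [map_smul, h0 m j (lt_of_le_of_ne this hjm), smul_zero]

/-- The functional which takes from a polynomial `Q` of operations the coefficient of `z ^ b` in the
evaluation of `Q_n(f)`. -/
noncomputable def wordFunctional (p n : ℕ) (b : Option ℕ →₀ ℕ) (f : RepAlg p) :
    Polynomial (Module.End (ZMod p) (RepAlg p)) →ₗ[ZMod p] ZMod p where
  toFun Q := MvPolynomial.coeff b (evalAt p 0 (Q.coeff n f))
  map_add' Q Q' := by simp
  map_smul' c Q := by simp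

theorem wordFunctional_apply (n : ℕ) (b : Option ℕ →₀ ℕ) (f : RepAlg p)
    (Q : Polynomial (Module.End (ZMod p) (RepAlg p))) :
    wordFunctional p n b f Q = MvPolynomial.coeff b (evalAt p 0 (Q.coeff n f)) := rfl

/-- The operations given by the basis words are linearly independent; the exponent of the
polynomial variable is the length of the word. -/
theorem linearIndependent_op [Fact p.Prime] :
    LinearIndependent (ZMod p) fun w : {w : List ℕ // IsDivBasisWord p r w} =>
      Polynomial.monomial w.1.length (w.1.map fun i : ℕ => op p r i).prod := by
  have hpp : p.Prime := Fact.out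
  have hp1 : p - 1 ≠ 0 := by have := hpp.one_lt; omega
  choose b f hb hf using fun w : {w : List ℕ // IsDivBasisWord p r w} => exists_weight_eq w.2
  have key : ∀ w v : {w : List ℕ // IsDivBasisWord p r w}, v ≤ w →
      wordFunctional p w.1.length (b w) (f w) (Polynomial.monomial v.1.length
        (v.1.map fun i : ℕ => op p r i).prod) = if v = w then 1 else 0 := by
    intro w v hvw
    rw [wordFunctional_apply, Polynomial.coeff_monomial]
    split_ifs with hlen hvw' hvw'
    · rw [coeff_evalAt_prod_op hp1 _ _ w.1 v.1 0 hlen hvw (by simpa using hb w),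
        if_pos (by rw [hvw']), zero_add, hf]
    · rw [coeff_evalAt_prod_op hp1 _ _ w.1 v.1 0 hlen hvw (by simpa using hb w),
        if_neg (fun h => hvw' (Subtype.ext h))]
    · exact absurd (by rw [hvw']) hlen
    · simp
  refine linearIndependent_of_triangular (K := ZMod p)
    (V := Polynomial (Module.End (ZMod p) (RepAlg p))) (ι := {w : List ℕ // IsDivBasisWord p r w})
    (fun w => wordFunctional p w.1.length (b w) (f w)) ?_ ?_
  · intro w v hvw
    rw [key w v hvw.le, if_neg hvw.ne]
  · intro w
    rw [key w w le_rfl, if_pos rfl]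

end

/-! ### Representations of the full quotients -/

section
variable {p r : ℕ}

theorem eHat_of_neg {i : ℤ} (hi : i < 0) : eHat p i = 0 := if_neg (not_le.2 hi)

theorem eHat_natCast (i : ℕ) : eHat p i = FreeAlgebra.ι (ZMod p) i := by simp [eHat]

theorem map_monomial {A B F : Type*} [Ring A] [Ring B] [FunLike F A B] [RingHomClass F A B] (f : F)
    (e : ℤ → A) (w : List ℕ) : f (monomial e w) = monomial (fun n => f (e n)) w := by
  simp [monomial, map_list_prod, Function.comp_def]

/-- The representation of `Û` which sends `e_i` to `e_i X`, where the polynomial variable records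
the length of a word. -/
noncomputable def opHom (p r : ℕ) :
    UHat p →ₐ[ZMod p] Polynomial (Module.End (ZMod p) (RepAlg p)) :=
  FreeAlgebra.lift (ZMod p) fun i : ℕ => Polynomial.monomial 1 (op p r i)

theorem opHom_eHat (i : ℤ) : opHom p r (eHat p i) = Polynomial.monomial 1 (op p r i) := by
  rcases lt_or_ge i 0 with h | h
  · rw [eHat_of_neg h, op_of_neg h, map_zero, map_zero]
  · lift i to ℕ using h
    rw [eHat_natCast, opHom, FreeAlgebra.lift_ι_apply]

variable {A : Type*} [Ring A] [Algebra (ZMod p) A] {e : ℤ → A}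

theorem map_monomial_eq (Φ : A →ₐ[ZMod p] Polynomial (Module.End (ZMod p) (RepAlg p)))
    (hΦ : ∀ i, Φ (e i) = Polynomial.monomial 1 (op p r i)) (w : List ℕ) :
    Φ (monomial e w) = Polynomial.monomial w.length (w.map fun i : ℕ => op p r i).prod := by
  rw [map_monomial]
  simp only [hΦ]
  induction w with
  | nil => rfl
  | cons i w ih =>
    rw [monomial] at ih
    simp only [monomial, List.map_cons, List.prod_cons, ih, Polynomial.monomial_mul_monomial,
      List.length_cons, add_comm]

theorem map_eq_of_fullRel [Fact p.Prime] (hp : p ≠ 2) (hr : Even r) {S : Set ℤ}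
    (Φ : A →ₐ[ZMod p] Polynomial (Module.End (ZMod p) (RepAlg p)))
    (hΦ : ∀ i, Φ (e i) = Polynomial.monomial 1 (op p r i)) ⦃x y : A⦄ (h : FullRel p e S x y) :
    Φ x = Φ y := by
  obtain ⟨i, j, -, -, rfl, rfl⟩ := h
  rw [map_theta, map_mul]
  simp only [hΦ, theta, Polynomial.monomial_mul_monomial]
  rw [op_mul_op hp hr, theta, map_sum]
  exact Finset.sum_congr rfl fun k _ =>
    map_zsmul (Polynomial.monomial (R := Module.End (ZMod p) (RepAlg p)) (1 + 1)) _ _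

/-- The basis words are linearly independent modulo the full relations. -/
theorem linearIndependent_full [Fact p.Prime] (hp : p ≠ 2) (hr : Even r) (S : Set ℤ)
    (Φ : A →ₐ[ZMod p] Polynomial (Module.End (ZMod p) (RepAlg p)))
    (hΦ : ∀ i, Φ (e i) = Polynomial.monomial 1 (op p r i)) :
    LinearIndependent (ZMod p) fun w : {w : List ℕ // IsDivBasisWord p r w} =>
      RingQuot.mkAlgHom (ZMod p) (FullRel p e S) (monomial e w.1) := by
  let Ψ : RingQuot (FullRel p e S) →ₐ[ZMod p] Polynomial (Module.End (ZMod p) (RepAlg p)) :=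
    RingQuot.liftAlgHom (ZMod p) ⟨Φ, map_eq_of_fullRel hp hr Φ hΦ⟩
  refine LinearIndependent.of_comp Ψ.toLinearMap ?_
  have h : (Ψ.toLinearMap ∘ fun w : {w : List ℕ // IsDivBasisWord p r w} =>
      RingQuot.mkAlgHom (ZMod p) (FullRel p e S) (monomial e w.1)) = fun w =>
        Polynomial.monomial w.1.length (w.1.map fun i : ℕ => op p r i).prod := by
    funext w
    simp only [Function.comp_apply, AlgHom.toLinearMap_apply, Ψ,
      RingQuot.liftAlgHom_mkAlgHom_apply]
    exact map_monomial_eq Φ hΦ w.1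
  rw [h]
  exact linearIndependent_op

end

/-! ### The negative relations follow from the Adem relations -/

theorem eq_zero_of_mem_span_of_linearIndependent {K V W ι : Type*} [Ring K] [AddCommGroup V]
    [Module K V] [AddCommGroup W] [Module K W] {v : ι → V} (f : V →ₗ[K] W)
    (h : LinearIndependent K fun i => f (v i)) {x : V} (hx : x ∈ Submodule.span K (Set.range v))
    (hfx : f x = 0) : x = 0 := by
  obtain ⟨c, rfl⟩ := (Finsupp.mem_span_range_iff_exists_finsupp).1 hx
  have hc : c = 0 := by
    apply linearIndependent_iff.1 h c
    rw [Finsupp.linearCombination_apply, ← hfx, map_finsuppSum]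
    simp
  simp [hc]

section
variable {p : ℕ}

theorem isDivBasisWord_two_iff {w : List ℕ} : IsDivBasisWord p 2 w ↔ IsBasisWord p w := by
  simp only [IsDivBasisWord, IsBasisWord, even_iff_two_dvd]

theorem linearIndependent_toKHatFull [Fact p.Prime] (hp : p ≠ 2) :
    LinearIndependent (ZMod p) fun w : {w : List ℕ // IsBasisWord p w ∧ 2 ≤ w.length} =>
      toKHatFull p (monomial (eHat p) w.1) := by
  have h := linearIndependent_full hp even_two Set.univ (opHom p 2) opHom_eHat
  refine h.comp (fun w : {w : List ℕ // IsBasisWord p w ∧ 2 ≤ w.length} =>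
    (⟨w.1, isDivBasisWord_two_iff.2 w.2.1⟩ : {w : List ℕ // IsDivBasisWord p 2 w})) ?_
  intro w v hwv
  exact Subtype.ext (Subtype.mk.inj hwv)

theorem eq_zero_of_add_self {R : Type*} [Ring R] [Algebra (ZMod p) R] [Fact p.Prime] (hp : p ≠ 2)
    (x : R) (h : x + x = 0) : x = 0 := by
  have h2 : (2 : ZMod p) ≠ 0 := by
    intro h
    have h' : ((2 : ℕ) : ZMod p) = 0 := by exact_mod_cast h
    rw [ZMod.natCast_eq_zero_iff, Nat.prime_dvd_prime_iff_eq Fact.out Nat.prime_two] at h'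
    exact hp h'
  rw [← two_smul (ZMod p)] at h
  exact (smul_eq_zero_iff_right h2).1 h

/-- In `K̂`, the right sides of the negative relations vanish: they are combinations of basis words
of length two, which stay linearly independent modulo the full relations. -/
theorem toKHat_theta_eq_zero [Fact p.Prime] (hp : p ≠ 2) {i j : ℤ} (hij : i < 0 ∨ j < 0) :
    toKHat p (theta p (eHat p) i j) = 0 := by
  have hpp : p.Prime := Fact.out
  let π : KHat p →ₐ[ZMod p] KHatFull p := RingQuot.liftAlgHom (ZMod p) ⟨toKHatFull p, by
    rintro _ _ ⟨i, j, hi, hj, -, -, rfl, rfl⟩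
    exact RingQuot.mkAlgHom_rel _ ⟨i, j, hi, hj, rfl, rfl⟩⟩
  have hπ : ∀ x, π (toKHat p x) = toKHatFull p x := fun x => by
    simp only [π, toKHat, RingQuot.liftAlgHom_mkAlgHom_apply]
  refine eq_zero_of_mem_span_of_linearIndependent
    (v := fun w : {w : List ℕ // IsBasisWord p w ∧ 2 ≤ w.length} =>
      toKHat p (monomial (eHat p) w.1)) π.toLinearMap ?_ ?_ ?_
  · simpa only [AlgHom.toLinearMap_apply, hπ] using linearIndependent_toKHatFull hp
  · rw [map_theta, theta]
    refine Submodule.sum_mem _ fun k _ => zsmul_mem ?_ _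
    refine Submodule.span_mono ?_ (mul_mem_span_basis (k := ZMod p) (p := p)
      (e := fun n => toKHat p (eHat p n)) hpp.one_lt
      (hpp.odd_of_ne_two hp) (eq_zero_of_add_self hp) ?_ ?_ _ _)
    · rintro _ ⟨a, b, ha, hab, ⟨hae, hd⟩, rfl⟩
      lift a to ℕ using ha
      lift b to ℕ using by omega
      have hab' : a ≤ b := by exact_mod_cast hab
      have hp1 : ((p - 1 : ℕ) : ℤ) = (p : ℤ) - 1 := by have := hpp.pos; omega
      have hd2 : (2 : ℤ) ∣ (p : ℤ) - 1 := by
        rw [← hp1]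
        exact_mod_cast (hpp.even_sub_one hp).two_dvd
      have hbe : Even (b : ℤ) :=
        (Int.even_sub.1 (even_iff_two_dvd.2 (hd2.trans hd))).2 hae
      refine ⟨⟨[a, b], ⟨?_, ?_⟩, le_rfl⟩, ?_⟩
      · simp only [List.mem_cons, List.not_mem_nil, or_false, forall_eq_or_imp, forall_eq]
        exact ⟨by exact_mod_cast hae, by exact_mod_cast hbe⟩
      · refine List.isChain_pair.2 ⟨hab', ?_⟩
        rw [Nat.modEq_iff_dvd, hp1]
        exact hd
      · simp [monomial]
    · intro n hn
      rw [eHat_of_neg hn, map_zero]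
    · intro i j hi hj
      rw [← map_mul, ← map_theta]
      exact RingQuot.mkAlgHom_rel _ ⟨i, j, trivial, trivial, hi, hj, rfl, rfl⟩
  · rw [AlgHom.toLinearMap_apply, hπ]
    have h : toKHatFull p (eHat p i * eHat p j) = toKHatFull p (theta p (eHat p) i j) :=
      RingQuot.mkAlgHom_rel _ ⟨i, j, trivial, trivial, rfl, rfl⟩
    rw [← h]
    rcases hij with h | h <;> simp [eHat_of_neg h]

/-- In every algebra with elements `e_i` which satisfy the Adem relations, the right sides of the
negative relations vanish. -/
theorem theta_eq_zero_of_neg [Fact p.Prime] (hp : p ≠ 2) {R : Type*} [Ring R] [Algebra (ZMod p) R]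
    {e : ℤ → R} (he : ∀ n < 0, e n = 0)
    (hrel : ∀ i j, 0 ≤ i → 0 ≤ j → e i * e j = theta p e i j) {i j : ℤ} (hij : i < 0 ∨ j < 0) :
    theta p e i j = 0 := by
  let Φ : UHat p →ₐ[ZMod p] R := FreeAlgebra.lift (ZMod p) fun n : ℕ => e n
  have hΦ : ∀ n, Φ (eHat p n) = e n := by
    intro n
    rcases lt_or_ge n 0 with h | h
    · rw [eHat_of_neg h, map_zero, he n h]
    · lift n to ℕ using h
      rw [eHat_natCast, FreeAlgebra.lift_ι_apply]
  let Ψ : KHat p →ₐ[ZMod p] R := RingQuot.liftAlgHom (ZMod p) ⟨Φ, by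
    rintro _ _ ⟨i, j, -, -, hi, hj, rfl, rfl⟩
    rw [map_mul, map_theta]
    simp only [hΦ]
    exact hrel i j hi hj⟩
  have h := congrArg Ψ (toKHat_theta_eq_zero hp hij)
  simp only [Ψ, toKHat, RingQuot.liftAlgHom_mkAlgHom_apply, map_zero] at h
  rw [map_theta] at h
  simpa only [hΦ] using h

/-- If `e_n = 0` outside of a union `S` of residue classes modulo `p - 1`, both sides of the
relation indexed by `(i, j)` vanish unless `i` and `j` lie in `S`. -/
theorem theta_eq_zero_of_notMem {R : Type*} [Ring R] {e : ℤ → R} {S : Set ℤ}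
    (hS : ∀ m n, ((p : ℤ) - 1) ∣ m - n → (m ∈ S ↔ n ∈ S)) (he : ∀ n ∉ S, e n = 0) {i j : ℤ}
    (hij : i ∉ S ∨ j ∉ S) : theta p e i j = 0 := by
  refine Finset.sum_eq_zero fun k _ => ?_
  by_cases hd : ((p : ℤ) - 1) ∣ (p * k - i)
  · have h1 : k ∈ S ↔ i ∈ S := hS k i <| by
      have := hd.sub (dvd_mul_right ((p : ℤ) - 1) k)
      rwa [show (p : ℤ) * k - i - ((p : ℤ) - 1) * k = k - i by ring] at this
    have h2 : i + p * j - p * k ∈ S ↔ j ∈ S := hS _ j <| by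
      have := (dvd_mul_right ((p : ℤ) - 1) j).sub hd
      rwa [show ((p : ℤ) - 1) * j - (p * k - i) = i + p * j - p * k - j by ring] at this
    rcases hij with h | h
    · rw [he k (mt h1.1 h), mul_zero, smul_zero]
    · rw [he _ (mt h2.1 h), zero_mul, smul_zero]
  · rw [coeff_eq_zero_of_not_dvd hd, zero_smul]

theorem exists_ringQuot_algEquiv {k A : Type*} [CommRing k] [Ring A] [Algebra k A]
    {r s : A → A → Prop}
    (hrs : ∀ ⦃x y⦄, r x y → RingQuot.mkAlgHom k s x = RingQuot.mkAlgHom k s y)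
    (hsr : ∀ ⦃x y⦄, s x y → RingQuot.mkAlgHom k r x = RingQuot.mkAlgHom k r y) :
    ∃ φ : RingQuot r ≃ₐ[k] RingQuot s,
      ∀ x, φ (RingQuot.mkAlgHom k r x) = RingQuot.mkAlgHom k s x := by
  refine ⟨AlgEquiv.ofAlgHom (RingQuot.liftAlgHom k ⟨RingQuot.mkAlgHom k s, hrs⟩)
    (RingQuot.liftAlgHom k ⟨RingQuot.mkAlgHom k r, hsr⟩) ?_ ?_, fun x => ?_⟩
  · apply RingQuot.ringQuot_ext'
    ext x
    simp
  · apply RingQuot.ringQuot_ext'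
    ext x
    simp
  · simp

/-- The Adem relations imply the full relations. -/
theorem exists_adem_algEquiv_full [Fact p.Prime] (hp : p ≠ 2) {A : Type*} [Ring A]
    [Algebra (ZMod p) A] {e : ℤ → A} {S : Set ℤ}
    (hS : ∀ m n, ((p : ℤ) - 1) ∣ m - n → (m ∈ S ↔ n ∈ S)) (he : ∀ n ∉ S, e n = 0)
    (hneg : ∀ n < 0, e n = 0) :
    ∃ φ : RingQuot (AdemRel p e S) ≃ₐ[ZMod p] RingQuot (FullRel p e S),
      ∀ x, φ (RingQuot.mkAlgHom (ZMod p) _ x) = RingQuot.mkAlgHom (ZMod p) _ x := by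
  refine exists_ringQuot_algEquiv ?_ ?_
  · rintro _ _ ⟨i, j, hi, hj, -, -, rfl, rfl⟩
    exact RingQuot.mkAlgHom_rel _ ⟨i, j, hi, hj, rfl, rfl⟩
  set π := RingQuot.mkAlgHom (ZMod p) (AdemRel p e S) with hπ
  have hrel : ∀ i j, 0 ≤ i → 0 ≤ j → π (e i) * π (e j) = theta p (fun n => π (e n)) i j := by
    intro i j hi hj
    by_cases hij : i ∈ S ∧ j ∈ S
    · rw [← map_mul, ← map_theta]
      exact RingQuot.mkAlgHom_rel _ ⟨i, j, hij.1, hij.2, hi, hj, rfl, rfl⟩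
    · rw [not_and_or] at hij
      rw [theta_eq_zero_of_notMem hS (fun n hn => by rw [he n hn, map_zero]) hij]
      rcases hij with h | h <;> simp [he _ h]
  rintro _ _ ⟨i, j, -, -, rfl, rfl⟩
  rw [map_mul, map_theta]
  by_cases hij : 0 ≤ i ∧ 0 ≤ j
  · exact hrel i j hij.1 hij.2
  · rw [not_and_or, not_le, not_le] at hij
    rw [theta_eq_zero_of_neg hp (fun n hn => by rw [hneg n hn, map_zero]) hrel hij]
    rcases hij with h | h <;> simp [hneg _ h]

end

/-! ### The quotients of `Û` by generators -/

section
variable {p : ℕ}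

theorem eTilde_eq_zero {i : ℤ} (hi : ¬ Even i) : eTilde p i = 0 := by
  have h := RingQuot.mkAlgHom_rel (ZMod p)
    (s := fun x y : UHat p => (∃ i : ℤ, ¬ Even i ∧ x = eHat p i) ∧ y = 0) ⟨⟨i, hi, rfl⟩, rfl⟩
  rw [eTilde, h, map_zero]

theorem eU_eq_zero {i : ℤ} (hi : ¬ ((p : ℤ) - 1) ∣ i) : eU p i = 0 := by
  have h := RingQuot.mkAlgHom_rel (ZMod p)
    (s := fun x y : UHat p => (∃ i : ℤ, ¬ (((p : ℤ) - 1) ∣ i) ∧ x = eHat p i) ∧ y = 0)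
    ⟨⟨i, hi, rfl⟩, rfl⟩
  rw [eU, h, map_zero]

theorem eTilde_of_neg {i : ℤ} (hi : i < 0) : eTilde p i = 0 := by
  rw [eTilde, eHat_of_neg hi, map_zero]

theorem eU_of_neg {i : ℤ} (hi : i < 0) : eU p i = 0 := by
  rw [eU, eHat_of_neg hi, map_zero]

theorem linearIndependent_toKTildeFull [Fact p.Prime] (hp : p ≠ 2) :
    LinearIndependent (ZMod p) fun w : {w : List ℕ // IsBasisWord p w} =>
      toKTildeFull p (monomial (eTilde p) w.1) := by
  have hpp : p.Prime := Fact.out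
  let Φ : UTilde p →ₐ[ZMod p] Polynomial (Module.End (ZMod p) (RepAlg p)) :=
    RingQuot.liftAlgHom (ZMod p) ⟨opHom p 2, by
      rintro _ _ ⟨⟨i, hi, rfl⟩, rfl⟩
      rw [opHom_eHat, op_eq_zero_of_not_dvd two_ne_zero (hpp.even_sub_one hp).two_dvd, map_zero,
        map_zero]
      exact fun h => hi (even_iff_two_dvd.2 (by exact_mod_cast h))⟩
  have hΦ : ∀ i, Φ (eTilde p i) = Polynomial.monomial 1 (op p 2 i) := fun i => by
    simp only [Φ, eTilde, RingQuot.liftAlgHom_mkAlgHom_apply, opHom_eHat]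
  have h := linearIndependent_full hp even_two {i | Even i} Φ hΦ
  refine h.comp (fun w : {w : List ℕ // IsBasisWord p w} =>
    (⟨w.1, isDivBasisWord_two_iff.2 w.2⟩ : {w : List ℕ // IsDivBasisWord p 2 w})) ?_
  intro w v hwv
  exact Subtype.ext (Subtype.mk.inj hwv)

theorem linearIndependent_toKFull [Fact p.Prime] (hp : p ≠ 2) :
    LinearIndependent (ZMod p) fun w : {w : List ℕ // w.IsChain (· ≤ ·)} =>
      toKFull p (monomial (dU p) w.1) := by
  have hpp : p.Prime := Fact.out
  have hp0 : p - 1 ≠ 0 := by have := hpp.one_lt; omega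
  have hp1 : ((p - 1 : ℕ) : ℤ) = (p : ℤ) - 1 := by have := hpp.pos; omega
  let Φ : U p →ₐ[ZMod p] Polynomial (Module.End (ZMod p) (RepAlg p)) :=
    RingQuot.liftAlgHom (ZMod p) ⟨opHom p (p - 1), by
      rintro _ _ ⟨⟨i, hi, rfl⟩, rfl⟩
      rw [opHom_eHat, op_eq_zero_of_not_dvd hp0 dvd_rfl (by rwa [hp1]), map_zero, map_zero]⟩
  have hΦ : ∀ i, Φ (eU p i) = Polynomial.monomial 1 (op p (p - 1) i) := fun i => by
    simp only [Φ, eU, RingQuot.liftAlgHom_mkAlgHom_apply, opHom_eHat]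
  have hword : ∀ w : {w : List ℕ // w.IsChain (· ≤ ·)},
      IsDivBasisWord p (p - 1) (w.1.map (· * (p - 1))) := by
    rintro ⟨w, hw⟩
    refine ⟨?_, ?_⟩
    · simp only [List.mem_map]
      rintro _ ⟨i, -, rfl⟩
      exact dvd_mul_left _ _
    · rw [List.isChain_map]
      refine hw.imp fun a b hab => ⟨Nat.mul_le_mul_right _ hab, ?_⟩
      simp [Nat.ModEq]
  have h := linearIndependent_full hp (hpp.even_sub_one hp) {i | ((p : ℤ) - 1) ∣ i} Φ hΦ
  have hinj : Function.Injective fun w : {w : List ℕ // w.IsChain (· ≤ ·)} =>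
      (⟨w.1.map (· * (p - 1)), hword w⟩ : {w : List ℕ // IsDivBasisWord p (p - 1) w}) := by
    intro w v hwv
    have h' : w.1.map (· * (p - 1)) = v.1.map (· * (p - 1)) := Subtype.ext_iff.1 hwv
    exact Subtype.ext (List.map_injective_iff.2
      (fun a b hab => Nat.eq_of_mul_eq_mul_right (Nat.pos_of_ne_zero hp0) hab) h')
  have h := h.comp _ hinj
  convert h using 2 with w
  simp [monomial, dU, Function.comp_def, hp1]

end
end KudoArakiMay

theorem theorem1p14 (p : ℕ) [Fact p.Prime] (hp : p ≠ 2) :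
    (LinearIndependent (ZMod p)
        (fun w : {w : List ℕ // KudoArakiMay.IsBasisWord p w ∧ 2 ≤ w.length} =>
          KudoArakiMay.toKHatFull p (KudoArakiMay.monomial (KudoArakiMay.eHat p) w.1)) ∧
      LinearIndependent (ZMod p)
        (fun w : {w : List ℕ // KudoArakiMay.IsBasisWord p w} =>
          KudoArakiMay.toKTildeFull p (KudoArakiMay.monomial (KudoArakiMay.eTilde p) w.1)) ∧
      LinearIndependent (ZMod p)
        (fun w : {w : List ℕ // w.IsChain (· ≤ ·)} =>
          KudoArakiMay.toKFull p (KudoArakiMay.monomial (KudoArakiMay.dU p) w.1))) ∧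
    ((∃ φ : KudoArakiMay.KHat p ≃ₐ[ZMod p] KudoArakiMay.KHatFull p,
        ∀ x, φ (KudoArakiMay.toKHat p x) = KudoArakiMay.toKHatFull p x) ∧
      (∃ φ : KudoArakiMay.KTilde p ≃ₐ[ZMod p] KudoArakiMay.KTildeFull p,
        ∀ x, φ (KudoArakiMay.toKTilde p x) = KudoArakiMay.toKTildeFull p x) ∧
      (∃ φ : KudoArakiMay.K p ≃ₐ[ZMod p] KudoArakiMay.KFull p,
        ∀ x, φ (KudoArakiMay.toK p x) = KudoArakiMay.toKFull p x)) := by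
  have hpp : p.Prime := Fact.out
  have hp1 : ((p - 1 : ℕ) : ℤ) = (p : ℤ) - 1 := by have := hpp.pos; omega
  have h2 : (2 : ℤ) ∣ (p : ℤ) - 1 := by
    rw [← hp1]
    exact_mod_cast (hpp.even_sub_one hp).two_dvd
  refine ⟨⟨KudoArakiMay.linearIndependent_toKHatFull hp,
    KudoArakiMay.linearIndependent_toKTildeFull hp, KudoArakiMay.linearIndependent_toKFull hp⟩,
    KudoArakiMay.exists_adem_algEquiv_full hp (fun _ _ _ => Iff.rfl)
      (fun n hn => absurd (Set.mem_univ n) hn) (fun _ => KudoArakiMay.eHat_of_neg),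
    KudoArakiMay.exists_adem_algEquiv_full hp (fun m n h => ?_)
      (fun _ => KudoArakiMay.eTilde_eq_zero) (fun _ => KudoArakiMay.eTilde_of_neg),
    KudoArakiMay.exists_adem_algEquiv_full hp (fun m n h => ?_)
      (fun _ => KudoArakiMay.eU_eq_zero) (fun _ => KudoArakiMay.eU_of_neg)⟩
  · exact Int.even_sub.1 (even_iff_two_dvd.2 (h2.trans h))
  · exact (dvd_iff_dvd_of_dvd_sub h)
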